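/- Let $\Gamma$ be a finite, undirected, simple, connected graph with distance function $d$ and diameter $D$ (the maximum distance between two vertices). Call $\Gamma$ distance-regular if there are integers $b_i, c_i$ ($0\le i\le D$) such that for any two vertices $x,y$ with $d(x,y)=i$, exactly $c_i$ neighbours of $y$ are at distance $i-1$ from $x$ and exactly $b_i$ neighbours of $y$ are at distance $i+1$ from $x$ (so $c_0=b_D=0$); then $\Gamma$ is regular with valency $k:=b_0$. Let $C\ge \frac12$ be a real number and $t$ a positive integer. Let $\Gamma$ be a distance-regular graph with valency $k$ and diameter $D\ge t+1$. If $\frac{b_t}{c_t}\le C$, then $D\le 8C^2t$ or $k\le 2C$. -/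

import Mathlib

/-- The connected graph `G` is distance-regular with intersection numbers `b i`, `c i`
(`0 ≤ i ≤ G.diam`): whenever `x, y` are at distance `i`, the vertex `y` has exactly `c i`
neighbours at distance `i - 1` from `x` (none if `i = 0`) and exactly `b i` neighbours at distance
`i + 1` from `x`. The values of `b` and `c` beyond the diameter are irrelevant; the valency is
`b 0`. -/
structure SimpleGraph.IsDistanceRegularWith {V : Type*} (G : SimpleGraph V) (b c : ℕ → ℕ) :
    Prop where
  connected : G.Connected
  ncard_closer : ∀ (i : ℕ) (x y : V), G.dist x y = i →
    {z : V | G.Adj y z ∧ G.dist x z + 1 = i}.ncard = c i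
  ncard_farther : ∀ (i : ℕ) (x y : V), G.dist x y = i →
    {z : V | G.Adj y z ∧ G.dist x z = i + 1}.ncard = b i

/-! ### Geodesics and neighbour sets -/

namespace SimpleGraph

variable {V : Type*} {G : SimpleGraph V} {b c : ℕ → ℕ}

/-! Geodesics give `c (D - t) ≤ b t ≤ C * c t`, so it is enough that `c` grows at least like a
square root, `c t ^ 2 * i ≤ 6 * t * c i ^ 2`: then `D - t ≤ 6 * C ^ 2 * t`. This growth needs `2 ≤ c
t`. If `c t = 1` and `k > 2 * C`, then `2 * b t < k` forces `2 ≤ c (2 * t)`, and `2 * t` takes the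
role of `t`.

The growth (`sq_mul_le_of_jump`) rests on two facts. At a jump, `c` is superadditive (`c_add_c_le`,
by double counting). Jumps are frequent: one at `q + 1` forces another by `3 * q`
(`c_lt_c_three_mul`). For the latter, suppose `c` is constant on `[q + 1, 3 * q]`. Nested sets of
closer neighbours then coincide, which makes long geodesics rigid. In a suitable configuration, this
rigidity makes one set of neighbours of the middle vertex larger than another by at least `c q`; the
reversed configuration gives the opposite inequality, which is absurd. -/

lemma Connected.dist_adj_bounds (h : G.Connected) {u v : V} (huv : G.Adj u v) (a : V) :
    G.dist a v ≤ G.dist a u + 1 ∧ G.dist a u ≤ G.dist a v + 1 := by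
  have h1 := dist_eq_one_iff_adj.2 huv
  have h2 := h.dist_triangle (u := a) (v := u) (w := v)
  have h3 := h.dist_triangle (u := a) (v := v) (w := u)
  have h4 := G.dist_comm (u := u) (v := v)
  omega

variable [Fintype V]

open Classical in
/-- The neighbours of `y` that are closer to `x` than `y` is. -/
noncomputable def closer (G : SimpleGraph V) (x y : V) : Finset V :=
  {z | G.Adj y z ∧ G.dist x z + 1 = G.dist x y}

open Classical in
/-- The neighbours of `y` that are farther from `x` than `y` is. -/
noncomputable def farther (G : SimpleGraph V) (x y : V) : Finset V :=
  {z | G.Adj y z ∧ G.dist x z = G.dist x y + 1}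

lemma mem_closer {x y z : V} : z ∈ G.closer x y ↔ G.Adj y z ∧ G.dist x z + 1 = G.dist x y := by
  simp [closer]

lemma mem_farther {x y z : V} :
    z ∈ G.farther x y ↔ G.Adj y z ∧ G.dist x z = G.dist x y + 1 := by
  simp [farther]

/-- Every vertex at positive distance from `x` has a neighbour closer to `x`. -/
lemma Connected.closer_nonempty (h : G.Connected) {x y : V} (hxy : 0 < G.dist x y) :
    (G.closer x y).Nonempty := by
  obtain ⟨p, hp⟩ := h.exists_walk_length_eq_dist y x
  cases p with
  | nil => simp at hxy
  | @cons _ z _ hyz p =>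
    refine ⟨z, mem_closer.2 ⟨hyz, ?_⟩⟩
    have h1 := G.dist_le p
    have h2 := h.dist_adj_bounds hyz x
    rw [Walk.length_cons] at hp
    rw [G.dist_comm (u := z)] at h1
    rw [G.dist_comm (u := y)] at hp
    omega

/-- Geodesics contain a vertex at every intermediate distance. -/
lemma Connected.exists_between (h : G.Connected) (x y : V) {i : ℕ} (hi : i ≤ G.dist x y) :
    ∃ z, G.dist x z = i ∧ G.dist x z + G.dist z y = G.dist x y := by
  obtain ⟨k, hk⟩ := Nat.exists_eq_add_of_le hi
  induction k generalizing y with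
  | zero => exact ⟨y, by simpa using hk, by simp⟩
  | succ k ih =>
    obtain ⟨y', hy'⟩ := h.closer_nonempty (x := x) (y := y) (by omega)
    rw [mem_closer] at hy'
    obtain ⟨z, hz, hzy⟩ := ih y' (by omega) (by omega)
    refine ⟨z, hz, ?_⟩
    have h1 := h.dist_adj_bounds hy'.1 z
    have h2 := h.dist_triangle (u := x) (v := z) (w := y)
    omega

/-- Closer neighbours with respect to a vertex on a geodesic are closer neighbours with respect to
its end point. -/
lemma Connected.closer_subset (h : G.Connected) {x z y : V}
    (hz : G.dist x z + G.dist z y = G.dist x y) : G.closer z y ⊆ G.closer x y := by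
  intro v hv
  rw [mem_closer] at hv ⊢
  have h1 := h.dist_triangle (u := x) (v := z) (w := v)
  have h2 := h.dist_adj_bounds hv.1 x
  exact ⟨hv.1, by omega⟩

lemma Connected.closer_subset_farther (h : G.Connected) {x y z : V}
    (hy : G.dist x y + G.dist y z = G.dist x z) : G.closer z y ⊆ G.farther x y := by
  intro v hv
  rw [mem_closer] at hv
  rw [mem_farther]
  have h1 := h.dist_triangle (u := x) (v := v) (w := z)
  have h2 := h.dist_adj_bounds hv.1 x
  rw [G.dist_comm (u := z), G.dist_comm (u := z)] at hv
  exact ⟨hv.1, by omega⟩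

/-! ### Monotonicity of `c` and superadditivity at jumps -/

namespace IsDistanceRegularWith

lemma card_closer (hG : G.IsDistanceRegularWith b c) (x y : V) :
    (G.closer x y).card = c (G.dist x y) := by
  rw [← hG.ncard_closer _ x y rfl, ← Set.ncard_coe_finset]
  congr 1
  ext z
  simp [mem_closer]

lemma card_farther (hG : G.IsDistanceRegularWith b c) (x y : V) :
    (G.farther x y).card = b (G.dist x y) := by
  rw [← hG.ncard_farther _ x y rfl, ← Set.ncard_coe_finset]
  congr 1
  ext z
  simp [mem_farther]

lemma dist_le_diam (hG : G.IsDistanceRegularWith b c) (x y : V) : G.dist x y ≤ G.diam := by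
  have := hG.connected.nonempty
  exact SimpleGraph.dist_le_diam (connected_iff_ediam_ne_top.1 hG.connected)

lemma exists_dist_eq (hG : G.IsDistanceRegularWith b c) {i : ℕ} (hi : i ≤ G.diam) :
    ∃ x y, G.dist x y = i := by
  have := hG.connected.nonempty
  obtain ⟨x, y, hxy⟩ := G.exists_dist_eq_diam
  obtain ⟨z, hz, -⟩ := hG.connected.exists_between x y (i := i) (by omega)
  exact ⟨x, z, hz⟩

lemma c_le_b (hG : G.IsDistanceRegularWith b c) {i j : ℕ} (hij : i + j ≤ G.diam) :
    c j ≤ b i := by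
  obtain ⟨x, z, hxz⟩ := hG.exists_dist_eq hij
  obtain ⟨y, hy, hyz⟩ := hG.connected.exists_between x z (i := i) (by omega)
  have := Finset.card_le_card (hG.connected.closer_subset_farther hyz)
  rwa [hG.card_closer, hG.card_farther, hy, G.dist_comm, show G.dist y z = j by omega] at this

lemma c_pos (hG : G.IsDistanceRegularWith b c) {i : ℕ} (hi : 1 ≤ i) (hiD : i ≤ G.diam) :
    1 ≤ c i := by
  obtain ⟨x, y, hxy⟩ := hG.exists_dist_eq hiD
  have := (hG.connected.closer_nonempty (x := x) (y := y) (by omega)).card_pos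
  rwa [hG.card_closer, hxy] at this

lemma c_one (hG : G.IsDistanceRegularWith b c) (hD : 1 ≤ G.diam) : c 1 = 1 := by
  obtain ⟨x, y, hxy⟩ := hG.exists_dist_eq hD
  have h := hG.card_closer x y
  rw [hxy] at h
  rw [← h, Finset.card_eq_one]
  refine ⟨x, ?_⟩
  ext z
  rw [mem_closer, Finset.mem_singleton, hxy]
  constructor
  · rintro ⟨-, hz⟩
    exact (hG.connected.dist_eq_zero_iff.1 (by omega)).symm
  · rintro rfl
    exact ⟨(dist_eq_one_iff_adj.1 hxy).symm, by simp⟩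

lemma c_mono (hG : G.IsDistanceRegularWith b c) {i j : ℕ} (hij : i ≤ j) (hj : j ≤ G.diam) :
    c i ≤ c j := by
  obtain ⟨x, y, hxy⟩ := hG.exists_dist_eq hj
  obtain ⟨z, hz, hzy⟩ := hG.connected.exists_between x y (i := j - i) (by omega)
  have := Finset.card_le_card (hG.connected.closer_subset hzy)
  rwa [hG.card_closer, hG.card_closer, hxy, show G.dist z y = i by omega] at this

/-- Geodesics extend up to the diameter. -/
lemma exists_extension (hG : G.IsDistanceRegularWith b c) (x y : V) {i : ℕ}
    (hi : G.dist x y + i ≤ G.diam) :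
    ∃ z, G.dist y z = i ∧ G.dist x z = G.dist x y + i := by
  induction i with
  | zero => exact ⟨y, by simp, by simp⟩
  | succ i ih =>
    obtain ⟨z, hz, hxz⟩ := ih (by omega)
    have h1 := hG.c_le_b (i := G.dist x z) (j := 1) (by omega)
    rw [hG.c_one (by omega), ← hG.card_farther] at h1
    obtain ⟨w, hw⟩ := Finset.card_pos.1 h1
    rw [mem_farther] at hw
    have h2 := hG.connected.dist_adj_bounds hw.1 y
    have h3 := hG.connected.dist_triangle (u := x) (v := y) (w := w)
    exact ⟨w, by omega, by omega⟩

lemma closer_eq (hG : G.IsDistanceRegularWith b c) {x z y : V}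
    (hz : G.dist x z + G.dist z y = G.dist x y) (h : c (G.dist z y) = c (G.dist x y)) :
    G.closer z y = G.closer x y :=
  Finset.eq_of_subset_of_card_le (hG.connected.closer_subset hz)
    (by rw [hG.card_closer, hG.card_closer, h])

open Classical in
/-- If `c` jumps at `i`, then `c j + c (i - j) ≤ c i`. -/
lemma c_add_c_le (hG : G.IsDistanceRegularWith b c) {i j l : ℕ} (hi : i ≤ G.diam)
    (hjump : c (i - 1) < c i) (hj : 1 ≤ j) (hl : 1 ≤ l) (hjl : j + l = i) : c j + c l ≤ c i := by
  obtain ⟨x, y, hxy⟩ := hG.exists_dist_eq hi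
  obtain ⟨z, hz, hzy⟩ := hG.connected.exists_between x y (i := j) (by omega)
  have hyx := G.dist_comm (u := x) (v := y)
  have hzx := G.dist_comm (u := x) (v := z)
  have hyz := G.dist_comm (u := y) (v := z)
  have hsub : G.closer z y ⊆ G.closer x y := hG.connected.closer_subset hzy
  have hsub' : G.closer z x ⊆ G.closer y x := hG.connected.closer_subset (by omega)
  -- Double counting of pairs with `d(u, v) ≠ i - 2`: each `u` has at least `c i - c (i - 1)`
  -- partners and each `v` at most that many. The jump makes this number positive, so it cancels.
  have key := Finset.card_mul_le_card_mul (s := G.closer z x) (t := G.closer x y \ G.closer z y)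
    (fun u v => G.dist u v + 2 ≠ i) (m := c i - c (i - 1)) (n := c i - c (i - 1)) ?_ ?_
  · rw [Finset.card_sdiff_of_subset hsub, hG.card_closer, hG.card_closer, hG.card_closer] at key
    have h1 := Nat.le_of_mul_le_mul_right key (by omega)
    rw [hxy, show G.dist z x = j by omega, show G.dist z y = l by omega] at h1
    have h2 := hG.c_mono (i := l) (j := i) (by omega) hi
    omega
  · intro u hu
    have hu' := mem_closer.1 (hsub' hu)
    rw [mem_closer] at hu
    have hux := G.dist_comm (u := x) (v := u)
    have huy := G.dist_comm (u := y) (v := u)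
    have hx := dist_eq_one_iff_adj.2 hu.1
    have h1 : G.closer u y ⊆ G.closer x y := hG.connected.closer_subset (by omega)
    have h2 : (G.closer x y \ G.closer u y).card = c i - c (i - 1) := by
      rw [Finset.card_sdiff_of_subset h1, hG.card_closer, hG.card_closer, hxy,
        show G.dist u y = i - 1 by omega]
    rw [← h2]
    refine Finset.card_le_card fun v hv => ?_
    rw [Finset.mem_sdiff] at hv
    have hv1 := mem_closer.1 hv.1
    have hv2 : G.dist u v + 2 ≠ i := fun h => hv.2 (mem_closer.2 ⟨hv1.1, by omega⟩)
    refine Finset.mem_filter.2 ⟨Finset.mem_sdiff.2 ⟨hv.1, fun h => hv2 ?_⟩, hv2⟩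
    rw [mem_closer] at h
    have t1 := hG.connected.dist_triangle (u := u) (v := z) (w := v)
    have t2 := hG.connected.dist_adj_bounds h.1 u
    have t3 := G.dist_comm (u := z) (v := u)
    omega
  · intro v hv
    rw [Finset.mem_sdiff] at hv
    have hv1 := mem_closer.1 hv.1
    have hvy := dist_eq_one_iff_adj.2 hv1.1
    have hvy' := G.dist_comm (u := y) (v := v)
    have hvx := G.dist_comm (u := x) (v := v)
    have h1 : G.closer v x ⊆ G.closer y x := hG.connected.closer_subset (by omega)
    have h2 : (G.closer y x \ G.closer v x).card = c i - c (i - 1) := by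
      rw [Finset.card_sdiff_of_subset h1, hG.card_closer, hG.card_closer,
        show G.dist y x = i by omega, show G.dist v x = i - 1 by omega]
    rw [← h2]
    refine Finset.card_le_card fun u hu => ?_
    rw [Finset.bipartiteBelow, Finset.mem_filter] at hu
    refine Finset.mem_sdiff.2 ⟨hsub' hu.1, fun h => hu.2 ?_⟩
    rw [mem_closer] at h
    have := G.dist_comm (u := u) (v := v)
    omega

end IsDistanceRegularWith

end SimpleGraph

/-! ### Rigidity of geodesics on a plateau of `c` -/

namespace SimpleGraph

variable {V : Type*} {G : SimpleGraph V} {b c : ℕ → ℕ}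

/-- Vertices `z, x, u, w, W` at successive distances `q` such that `z, x, u, w` and `x, u, w, W`
lie on geodesics, a neighbour `τ` of `w` on a geodesic from `z` and a neighbour `v` of `x` on a
geodesic from `W`, both at distance `q` from `u`. -/
structure IsGeodesicConfig (G : SimpleGraph V) (q : ℕ) (z x u w W τ v : V) : Prop where
  dist_zx : G.dist z x = q
  dist_xu : G.dist x u = q
  dist_uw : G.dist u w = q
  dist_wW : G.dist w W = q
  dist_zw : G.dist z w = 3 * q
  dist_xW : G.dist x W = 3 * q
  adj_wτ : G.Adj w τ
  adj_xv : G.Adj x v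
  dist_zτ : G.dist z τ + 1 = 3 * q
  dist_vW : G.dist v W + 1 = 3 * q
  dist_uτ : G.dist u τ = q
  dist_vu : G.dist v u = q
  dist_xτ : G.dist x τ + 1 = 2 * q
  dist_vw : G.dist v w + 1 = 2 * q

lemma IsGeodesicConfig.symm {q : ℕ} {z x u w W τ v : V}
    (h : G.IsGeodesicConfig q z x u w W τ v) : G.IsGeodesicConfig q W w u x z v τ where
  dist_zx := G.dist_comm.trans h.dist_wW
  dist_xu := G.dist_comm.trans h.dist_uw
  dist_uw := G.dist_comm.trans h.dist_xu
  dist_wW := G.dist_comm.trans h.dist_zx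
  dist_zw := G.dist_comm.trans h.dist_xW
  dist_xW := G.dist_comm.trans h.dist_zw
  adj_wτ := h.adj_xv
  adj_xv := h.adj_wτ
  dist_zτ := by rw [G.dist_comm, h.dist_vW]
  dist_vW := by rw [G.dist_comm, h.dist_zτ]
  dist_uτ := G.dist_comm.trans h.dist_vu
  dist_vu := G.dist_comm.trans h.dist_uτ
  dist_xτ := by rw [G.dist_comm, h.dist_vw]
  dist_vw := by rw [G.dist_comm, h.dist_xτ]

namespace IsGeodesicConfig

variable {q : ℕ} {z x u w W τ v : V}

lemma dist_zu (h : G.IsGeodesicConfig q z x u w W τ v) (hG : G.Connected) :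
    G.dist z u = 2 * q := by
  have h1 := hG.dist_triangle (u := z) (v := x) (w := u)
  have h2 := hG.dist_triangle (u := z) (v := u) (w := w)
  have := h.dist_zx
  have := h.dist_xu
  have := h.dist_uw
  have := h.dist_zw
  omega

lemma dist_zv (h : G.IsGeodesicConfig q z x u w W τ v) (hG : G.Connected) :
    G.dist z v = q + 1 := by
  have h1 := hG.dist_adj_bounds h.adj_xv z
  have h2 := hG.dist_triangle (u := z) (v := v) (w := w)
  have := h.dist_zx
  have := h.dist_vw
  have := h.dist_zw
  omega

end IsGeodesicConfig

variable [Fintype V]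

namespace IsDistanceRegularWith

/-- If `c` is constant on `[q + 1, 3 q]`, then in an interval of length at most `3 q` two vertices
whose levels differ by at least `q` lie on a common geodesic. -/
lemma dist_add_dist_of_plateau (hG : G.IsDistanceRegularWith b c) {q : ℕ}
    (hc : ∀ i, q + 1 ≤ i → i ≤ 3 * q → c i = c (q + 1)) {z T x y : V}
    (hT : G.dist z T ≤ 3 * q) (hx : G.dist z x + G.dist x T = G.dist z T)
    (hy : G.dist z y + G.dist y T = G.dist z T) (hxy : G.dist z x + q ≤ G.dist z y) :
    G.dist z x + G.dist x y = G.dist z y := by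
  obtain ⟨n, hn⟩ : ∃ n, G.dist y T = n := ⟨_, rfl⟩
  induction n generalizing y with
  | zero =>
    obtain rfl := hG.connected.dist_eq_zero_iff.1 hn
    exact hx
  | succ n ih =>
    have hTy := G.dist_comm (u := T) (v := y)
    obtain ⟨y', hy'⟩ := hG.connected.closer_nonempty (x := T) (y := y) (by omega)
    rw [mem_closer] at hy'
    have hTy' := G.dist_comm (u := T) (v := y')
    have h1 := hG.connected.dist_triangle (u := z) (v := y') (w := T)
    have h2 := hG.connected.dist_adj_bounds hy'.1 z
    have h3 := ih (y := y') (by omega) (by omega) (by omega)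
    -- Both `d(x, y')` and `d(z, y')` lie on the plateau, so the nested sets `closer x y'` and
    -- `closer z y'` are equal.
    have h4 : y ∈ G.closer x y' := by
      rw [hG.closer_eq h3 ((hc _ (by omega) (by omega)).trans (hc _ (by omega) (by omega)).symm)]
      exact mem_closer.2 ⟨hy'.1.symm, by omega⟩
    rw [mem_closer] at h4
    omega

/-- Otherwise `d(y, τ) = q + 1`, and `closer z y = closer τ y`. A step from `y` towards the
successor `τ'` of `τ` would then also be a step towards `z`, which contradicts the level of `τ'`. -/
lemma dist_le_of_plateau (hG : G.IsDistanceRegularWith b c) {q : ℕ} (hq : 1 ≤ q)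
    (hc : ∀ i, q + 1 ≤ i → i ≤ 3 * q → c i = c (q + 1)) {z T y τ : V}
    (hT : G.dist z T ≤ 3 * q) (hy : G.dist z y + G.dist y T = G.dist z T)
    (hτ : G.dist z τ + G.dist τ T = G.dist z T) (hy' : q + 1 ≤ G.dist z y)
    (hyτ : G.dist z τ + 1 = G.dist z y + q) (hτ' : G.dist z τ < G.dist z T) :
    G.dist y τ ≤ q := by
  by_contra! hlt
  have hTτ := G.dist_comm (u := T) (v := τ)
  obtain ⟨τ', hτ1⟩ := hG.connected.closer_nonempty (x := T) (y := τ) (by omega)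
  rw [mem_closer] at hτ1
  have hTτ' := G.dist_comm (u := T) (v := τ')
  have h1 := hG.connected.dist_triangle (u := z) (v := τ') (w := T)
  have h2 := hG.connected.dist_adj_bounds hτ1.1 z
  have h3 := hG.dist_add_dist_of_plateau hc hT hy (y := τ') (by omega) (by omega)
  have h4 := hG.connected.dist_adj_bounds hτ1.1 y
  have hyτc := G.dist_comm (u := y) (v := τ)
  have hyτc' := G.dist_comm (u := y) (v := τ')
  have h5 : G.closer z y = G.closer τ y := by
    refine Finset.eq_of_subset_of_card_le (fun r hr => ?_) ?_
    · rw [mem_closer] at hr ⊢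
      have t1 := hG.connected.dist_adj_bounds hr.1 T
      have t2 := hG.connected.dist_triangle (u := z) (v := r) (w := T)
      have t3 := G.dist_comm (u := T) (v := r)
      have t4 := G.dist_comm (u := T) (v := y)
      have t5 := hG.dist_add_dist_of_plateau hc hT (x := r) (y := τ) (by omega) hτ (by omega)
      have t6 := G.dist_comm (u := τ) (v := r)
      exact ⟨hr.1, by omega⟩
    · rw [hG.card_closer, hG.card_closer, hc (G.dist z y) (by omega) (by omega),
        show G.dist τ y = q + 1 by omega]
  obtain ⟨r, hr⟩ := hG.connected.closer_nonempty (x := τ') (y := y) (by omega)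
  rw [mem_closer] at hr
  have t1 := hG.connected.dist_adj_bounds hτ1.1 r
  have t2 := hG.connected.dist_adj_bounds hr.1 τ
  have t3 := G.dist_comm (u := τ) (v := r)
  have t4 := G.dist_comm (u := τ') (v := r)
  have h6 : r ∈ G.closer z y := h5 ▸ mem_closer.2 ⟨hr.1, by omega⟩
  rw [mem_closer] at h6
  have t5 := hG.connected.dist_triangle (u := z) (v := r) (w := τ')
  omega

/-- If `d(g, e) = q`, then `g` lies on a geodesic from `u` to any extension `E` beyond `e`. Hence
`closer E w = closer g w`, and a step from `w` towards `u` would also approach `E`. -/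
lemma lt_dist_of_plateau (hG : G.IsDistanceRegularWith b c) {q : ℕ} (hq : 1 ≤ q)
    (hD : 3 * q ≤ G.diam) (hc : ∀ i, q + 1 ≤ i → i ≤ 3 * q → c i = c (q + 1)) {u w g e : V}
    (huw : G.dist u w = q) (hg : G.Adj u g) (hgw : G.dist g w = q + 1) (he : G.Adj w e)
    (hue : G.dist u e = q + 1) : q < G.dist g e := by
  by_contra! hle
  have s1 := hG.connected.dist_adj_bounds he g
  obtain ⟨E, heE, huE⟩ := hG.exists_extension u e (i := q) (by omega)
  have c1 := G.dist_comm (u := u) (v := e)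
  have c2 := G.dist_comm (u := g) (v := e)
  have c3 := G.dist_comm (u := E) (v := e)
  have c4 := G.dist_comm (u := E) (v := u)
  have c5 := G.dist_comm (u := E) (v := w)
  have c6 := G.dist_comm (u := E) (v := g)
  have hgE : g ∈ G.closer E u := by
    rw [← hG.closer_eq (x := E) (z := e) (y := u) (by omega)
      ((hc _ (by omega) (by omega)).trans (hc _ (by omega) (by omega)).symm)]
    exact mem_closer.2 ⟨hg, by omega⟩
  rw [mem_closer] at hgE
  have s2 := hG.connected.dist_adj_bounds he E
  have s3 := hG.connected.dist_triangle (u := u) (v := w) (w := E)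
  have hug := dist_eq_one_iff_adj.2 hg
  have h1 : G.closer E w = G.closer g w := by
    refine Finset.eq_of_subset_of_card_le (fun s hs => ?_) ?_
    · rw [mem_closer] at hs ⊢
      have t1 := hG.connected.dist_adj_bounds hs.1 u
      have t2 := hG.connected.dist_triangle (u := u) (v := s) (w := E)
      have t3 := G.dist_comm (u := E) (v := s)
      have t4 := hG.dist_add_dist_of_plateau hc (z := u) (T := E) (x := g) (y := s) (by omega)
        (by omega) (by omega) (by omega)
      exact ⟨hs.1, by omega⟩
    · rw [hG.card_closer, hG.card_closer, show G.dist g w = q + 1 by omega,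
        show G.dist E w = q + 1 by omega]
  obtain ⟨r, hr⟩ := hG.connected.closer_nonempty (x := u) (y := w) (by omega)
  rw [mem_closer] at hr
  have t1 := hG.connected.dist_adj_bounds hg r
  have t2 := hG.connected.dist_adj_bounds hr.1 g
  have t3 := G.dist_comm (u := r) (v := u)
  have t4 := G.dist_comm (u := r) (v := g)
  have h2 : r ∈ G.closer E w := h1 ▸ mem_closer.2 ⟨hr.1, by omega⟩
  rw [mem_closer] at h2
  have t5 := hG.connected.dist_triangle (u := u) (v := r) (w := E)
  have t6 := G.dist_comm (u := r) (v := E)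
  omega

end IsDistanceRegularWith

namespace IsGeodesicConfig

variable {q : ℕ} {z x u w W τ v : V}

lemma dist_zg_and_dist_wg (h : G.IsGeodesicConfig q z x u w W τ v)
    (hG : G.IsDistanceRegularWith b c) (hq : 1 ≤ q)
    (hc : ∀ i, q + 1 ≤ i → i ≤ 3 * q → c i = c (q + 1)) {g : V} (hg : G.Adj u g)
    (hxg : G.dist x g ≤ q) (hτg : G.dist τ g = q + 1) :
    G.dist z g = 2 * q ∧ G.dist w g = q + 1 := by
  have dzu := h.dist_zu hG.connected
  have dzx := h.dist_zx
  have dwu := h.symm.dist_xu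
  have dzw := h.dist_zw
  have dzτ := h.dist_zτ
  have dτw := dist_eq_one_iff_adj.2 h.adj_wτ.symm
  rw [G.dist_comm (u := w) (v := g)]
  rw [G.dist_comm] at dwu hτg
  have s1 := hG.connected.dist_triangle (u := z) (v := x) (w := g)
  have s2 := hG.connected.dist_adj_bounds hg z
  have s3 := hG.connected.dist_adj_bounds hg w
  rw [G.dist_comm (u := w) (v := g), G.dist_comm (u := w) (v := u)] at s3
  have s5 := hG.connected.dist_triangle (u := z) (v := g) (w := w)
  have dzg : G.dist z g = 2 * q := by
    by_contra hne
    have := hG.dist_add_dist_of_plateau hc (z := z) (T := w) (x := g) (y := τ) (by omega)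
      (by omega) (by omega) (by omega)
    omega
  refine ⟨dzg, ?_⟩
  by_contra hne
  have := hG.dist_le_of_plateau hq hc (z := z) (T := w) (y := g) (τ := τ) (by omega)
    (by omega) (by omega) (by omega) (by omega) (by omega)
  omega

/-- The sets `closer g w` and `closer z w` have equal size by the plateau, but `τ` is only in the
second; `e` is chosen in the first only. -/
lemma exists_dist_eq (h : G.IsGeodesicConfig q z x u w W τ v)
    (hG : G.IsDistanceRegularWith b c) (hq : 1 ≤ q) (hD : 3 * q ≤ G.diam)
    (hc : ∀ i, q + 1 ≤ i → i ≤ 3 * q → c i = c (q + 1)) {g : V} (hg : G.Adj u g)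
    (hτg : G.dist τ g = q + 1) (dzg : G.dist z g = 2 * q) (dwg : G.dist w g = q + 1) :
    ∃ e, G.dist z e = 3 * q ∧ G.dist u e = q ∧ G.dist g e = q := by
  have dzu := h.dist_zu hG.connected
  have duw := h.dist_uw
  have dzw := h.dist_zw
  have dzτ := h.dist_zτ
  rw [G.dist_comm] at hτg dwg
  obtain ⟨e, he, hze⟩ : ∃ e ∈ G.closer g w, e ∉ G.closer z w := by
    by_contra! hsub
    have heq := Finset.eq_of_subset_of_card_le hsub
      (by rw [hG.card_closer, hG.card_closer, dwg, dzw, hc (3 * q) (by omega) le_rfl])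
    have hτ : τ ∈ G.closer g w := heq ▸ mem_closer.2 ⟨h.adj_wτ, by omega⟩
    rw [mem_closer] at hτ
    omega
  rw [mem_closer] at he
  have s1 := hG.connected.dist_adj_bounds he.1 z
  have s2 := hG.connected.dist_triangle (u := z) (v := g) (w := e)
  have s3 : G.dist z e + 1 ≠ G.dist z w := fun h => hze (mem_closer.2 ⟨he.1, h⟩)
  have s4 := hG.connected.dist_adj_bounds he.1 u
  have s5 := hG.connected.dist_triangle (u := z) (v := u) (w := e)
  refine ⟨e, by omega, ?_, by omega⟩
  by_contra hne
  have := hG.lt_dist_of_plateau hq hD hc duw hg dwg he.1 (by omega)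
  omega

lemma dist_of_adj (h : G.IsGeodesicConfig q z x u w W τ v) (hG : G.IsDistanceRegularWith b c)
    (hq : 1 ≤ q) (hD : 3 * q ≤ G.diam)
    (hc : ∀ i, q + 1 ≤ i → i ≤ 3 * q → c i = c (q + 1)) {g : V} (hg : G.Adj u g)
    (hxg : G.dist x g ≤ q) (hτg : G.dist τ g = q + 1) :
    G.dist w g = q + 1 ∧ G.dist v g ≤ q := by
  obtain ⟨dzg, dwg⟩ := h.dist_zg_and_dist_wg hG hq hc hg hxg hτg
  obtain ⟨e, dze, due, dge⟩ := h.exists_dist_eq hG hq hD hc hg hτg dzg dwg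
  refine ⟨dwg, ?_⟩
  by_contra! hvg
  have dzu := h.dist_zu hG.connected
  have dzv := h.dist_zv hG.connected
  have dzw := h.dist_zw
  have duw := h.dist_uw
  have dvu := h.dist_vu
  have dwv := h.symm.dist_xτ
  have s4 := hG.connected.dist_adj_bounds hg v
  have dgv : G.dist g v = q + 1 := by
    rw [G.dist_comm]
    omega
  clear dwg hxg hτg s4 hvg
  -- The vertices `u` and `g` are both on geodesics from `z` to `e`, so a step from `v` towards `z`
  -- lands at distance `q` from both.
  have heq : G.closer z v = G.closer g v := by
    refine Finset.eq_of_subset_of_card_le (fun p hp => ?_) ?_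
    · rw [mem_closer] at hp ⊢
      have t1 := hG.connected.dist_adj_bounds hp.1 w
      rw [G.dist_comm (u := w) (v := p)] at t1
      have t4 := hG.connected.dist_triangle (u := z) (v := p) (w := w)
      have t5 := hG.dist_add_dist_of_plateau hc (z := z) (T := w) (x := p) (y := u) (by omega)
        (by omega) (by omega) (by omega)
      have t6 := hG.connected.dist_triangle (u := p) (v := u) (w := e)
      have t7 := hG.connected.dist_triangle (u := z) (v := p) (w := e)
      have t8 := hG.dist_add_dist_of_plateau hc (z := z) (T := e) (x := p) (y := g) (by omega)
        (by omega) (by omega) (by omega)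
      rw [G.dist_comm (u := g) (v := p)]
      exact ⟨hp.1, by omega⟩
    · rw [hG.card_closer, hG.card_closer, dzv, dgv]
  rw [G.dist_comm] at dvu
  obtain ⟨r, hr⟩ := hG.connected.closer_nonempty (x := u) (y := v) (by omega)
  rw [mem_closer] at hr
  have t1 := hG.connected.dist_adj_bounds hg r
  have t2 := hG.connected.dist_adj_bounds hr.1 g
  rw [G.dist_comm (u := r) (v := u), G.dist_comm (u := r) (v := g)] at t1
  have hr' : r ∈ G.closer z v := heq ▸ mem_closer.2 ⟨hr.1, by omega⟩
  rw [mem_closer] at hr'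
  have t5 := hG.connected.dist_triangle (u := z) (v := r) (w := u)
  rw [G.dist_comm (u := r) (v := u)] at t5
  omega

lemma dist_of_mem_closer (h : G.IsGeodesicConfig q z x u w W τ v)
    (hG : G.IsDistanceRegularWith b c) (hc : ∀ i, q + 1 ≤ i → i ≤ 3 * q → c i = c (q + 1)) {g : V}
    (hg : g ∈ G.closer w u) :
    G.dist τ g ≤ q ∧ G.dist x g = q + 1 ∧ G.dist v g ≤ q := by
  have dzu := h.dist_zu hG.connected
  have dzv := h.dist_zv hG.connected
  have dzw := h.dist_zw
  have dzx := h.dist_zx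
  have dxu := h.dist_xu
  have dwu := h.symm.dist_xu
  have dvw := h.dist_vw
  have dτw := dist_eq_one_iff_adj.2 h.adj_wτ.symm
  rw [mem_closer] at hg
  have s1 := hG.connected.dist_triangle (u := τ) (v := w) (w := g)
  have s2 := hG.connected.dist_adj_bounds hg.1 x
  have s3 := hG.connected.dist_adj_bounds hg.1 z
  have s4 := hG.connected.dist_triangle (u := z) (v := x) (w := g)
  have s5 := hG.connected.dist_triangle (u := z) (v := g) (w := w)
  rw [G.dist_comm (u := w) (v := g)] at s1 hg
  have s6 := hG.dist_add_dist_of_plateau hc (z := z) (T := w) (x := v) (y := g) (by omega)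
    (by omega) (by omega) (by omega)
  exact ⟨by omega, by omega, by omega⟩

open Classical in
-- The set on the right has the size of `farther x u \ farther τ u`, which contains the disjoint
-- sets `farther v u \ farther w u` and `closer w u`.
lemma card_add_le_card (h : G.IsGeodesicConfig q z x u w W τ v)
    (hG : G.IsDistanceRegularWith b c) (hq : 1 ≤ q) (hD : 3 * q ≤ G.diam)
    (hc : ∀ i, q + 1 ≤ i → i ≤ 3 * q → c i = c (q + 1)) :
    (G.farther v u \ G.farther w u).card + c q ≤ (G.farther τ u \ G.farther x u).card := by
  have dvu := h.dist_vu
  have dwu := h.symm.dist_xu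
  have dτu := h.symm.dist_vu
  have dxu := h.dist_xu
  rw [Finset.card_sdiff_comm (s := G.farther τ u) (t := G.farther x u)
    (by rw [hG.card_farther, hG.card_farther, dτu, dxu])]
  have hcq : c q = (G.closer w u).card := by rw [hG.card_closer, dwu]
  rw [hcq, ← Finset.card_union_of_disjoint]
  · refine Finset.card_le_card fun g hg => ?_
    rw [Finset.mem_union, Finset.mem_sdiff] at hg
    rw [Finset.mem_sdiff, mem_farther, mem_farther]
    rcases hg with ⟨h1, h2⟩ | h1
    · rw [mem_farther] at h1 h2
      have h3 := hG.connected.dist_adj_bounds h1.1 w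
      have h4 : G.dist w g ≠ G.dist w u + 1 := fun h => h2 ⟨h1.1, h⟩
      have h5 := h.symm.dist_of_adj hG hq hD hc h1.1 (by omega) (by omega)
      exact ⟨⟨h1.1, by omega⟩, by omega⟩
    · have h2 := h.dist_of_mem_closer hG hc h1
      exact ⟨⟨(mem_closer.1 h1).1, by omega⟩, by omega⟩
  · rw [Finset.disjoint_left]
    intro g hg hg'
    rw [Finset.mem_sdiff, mem_farther] at hg
    have h2 := h.dist_of_mem_closer hG hc hg'
    omega

end IsGeodesicConfig

/-! ### Frequency of jumps and growth of `c` -/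

namespace IsDistanceRegularWith

/-- A jump of `c` at `q + 1` is followed by another one up to `3 q`. -/
lemma c_lt_c_three_mul (hG : G.IsDistanceRegularWith b c) {q : ℕ} (hq : 1 ≤ q)
    (hD : 3 * q ≤ G.diam) (hjump : c q < c (q + 1)) : c (q + 1) < c (3 * q) := by
  by_contra! hle
  have hc : ∀ i, q + 1 ≤ i → i ≤ 3 * q → c i = c (q + 1) := fun i h1 h2 =>
    le_antisymm ((hG.c_mono h2 hD).trans hle) (hG.c_mono h1 (by omega))
  obtain ⟨z, w, dzw⟩ := hG.exists_dist_eq hD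
  obtain ⟨x, dzx, hx⟩ := hG.connected.exists_between z w (i := q) (by omega)
  obtain ⟨u, dxu, hu⟩ := hG.connected.exists_between x w (i := q) (by omega)
  obtain ⟨W, dwW, dxW⟩ := hG.exists_extension x w (i := q) (by omega)
  have c1 := G.dist_comm (u := u) (v := x)
  have c2 := G.dist_comm (u := W) (v := x)
  have c3 := G.dist_comm (u := W) (v := w)
  have c4 := G.dist_comm (u := w) (v := x)
  have c5 := G.dist_comm (u := W) (v := u)
  have s1 := hG.connected.dist_triangle (u := z) (v := x) (w := u)
  have s2 := hG.connected.dist_triangle (u := z) (v := u) (w := w)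
  have s3 := hG.connected.dist_triangle (u := u) (v := w) (w := W)
  have s4 := hG.connected.dist_triangle (u := x) (v := u) (w := W)
  obtain ⟨τ, hτ, hτ'⟩ := Finset.exists_mem_notMem_of_card_lt_card
    (s := G.closer u w) (t := G.closer z w)
    (by rwa [hG.card_closer, hG.card_closer, dzw, show G.dist u w = q by omega,
      hc _ (by omega) le_rfl])
  obtain ⟨v, hv, hv'⟩ := Finset.exists_mem_notMem_of_card_lt_card
    (s := G.closer u x) (t := G.closer W x)
    (by rwa [hG.card_closer, hG.card_closer, show G.dist W x = 3 * q by omega,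
      show G.dist u x = q by omega, hc _ (by omega) le_rfl])
  rw [mem_closer] at hτ hτ' hv hv'
  have e1 := dist_eq_one_iff_adj.2 hτ.1
  have e2 := dist_eq_one_iff_adj.2 hv.1
  have c6 := G.dist_comm (u := w) (v := τ)
  have c7 := G.dist_comm (u := x) (v := v)
  have c8 := G.dist_comm (u := W) (v := v)
  have c9 := G.dist_comm (u := w) (v := v)
  have c10 := G.dist_comm (u := u) (v := v)
  have s5 := hG.dist_add_dist_of_plateau hc (z := z) (T := w) (x := x) (y := τ) (by omega)
    (by omega) (by omega) (by omega)
  have s6 := hG.dist_add_dist_of_plateau hc (z := W) (T := x) (x := w) (y := v) (by omega)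
    (by omega) (by omega) (by omega)
  have s7 := hG.dist_le_of_plateau hq hc (z := z) (T := w) (y := u) (τ := τ) (by omega)
    (by omega) (by omega) (by omega) (by omega) (by omega)
  have s8 := hG.dist_le_of_plateau hq hc (z := W) (T := x) (y := u) (τ := v) (by omega)
    (by omega) (by omega) (by omega) (by omega) (by omega)
  have s9 := hG.connected.dist_adj_bounds hτ.1 u
  have s10 := hG.connected.dist_adj_bounds hv.1 u
  have s11 : G.dist u τ + 1 ≠ G.dist u w := fun h => hτ' ⟨hτ.1, h⟩
  have s12 : G.dist u v + 1 ≠ G.dist u x := fun h => hv' ⟨hv.1, h⟩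
  have h : G.IsGeodesicConfig q z x u w W τ v :=
    ⟨dzx, dxu, by omega, dwW, dzw, by omega, hτ.1, hv.1, by omega, by omega,
      by omega, by omega, by omega, by omega⟩
  -- Adding this to its mirror image gives `2 * c q ≤ 0`.
  have k1 := h.card_add_le_card hG hq hD hc
  have k2 := h.symm.card_add_le_card hG hq hD hc
  have k3 := hG.c_pos hq (by omega)
  omega

/-- The last jump of `c` up to `i` is at some `j > i / 3`. -/
lemma exists_last_jump (hG : G.IsDistanceRegularWith b c) {i : ℕ} (hi : i ≤ G.diam)
    (hci : 2 ≤ c i) : ∃ j, 2 ≤ j ∧ j ≤ i ∧ c (j - 1) < c j ∧ c j = c i ∧ i < 3 * j := by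
  classical
  have hex : ∃ j, c j = c i := ⟨i, rfl⟩
  obtain ⟨j, hj, hmin⟩ : ∃ j, c j = c i ∧ ∀ l < j, c l ≠ c i :=
    ⟨Nat.find hex, Nat.find_spec hex, fun l hl => Nat.find_min hex hl⟩
  have hji : j ≤ i := not_lt.1 fun h => hmin i h rfl
  have hj2 : 2 ≤ j := by
    by_contra! h
    obtain rfl | hD := Nat.eq_zero_or_pos i
    · have h1 : (G.closer hG.connected.nonempty.some hG.connected.nonempty.some).card = c 0 := by
        rw [hG.card_closer, dist_self]
      rw [Finset.card_eq_zero.2] at h1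
      · omega
      · ext z
        simp [mem_closer]
    · have h1 := hG.c_mono (i := j) (j := 1) (by omega) (by omega)
      have h2 := hG.c_one (by omega)
      omega
  have hjump : c (j - 1) < c j := by
    have h1 := hG.c_mono (i := j - 1) (j := j) (by omega) (by omega)
    have h2 := hmin (j - 1) (by omega)
    omega
  refine ⟨j, hj2, hji, hjump, hj, ?_⟩
  by_contra! h
  obtain ⟨q, rfl⟩ : ∃ q, j = q + 1 := ⟨j - 1, by omega⟩
  have h1 := hG.c_lt_c_three_mul (q := q) (by omega) (by omega) hjump
  have h2 := hG.c_mono (i := 3 * q) (j := i) (by omega) hi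
  omega

/-- At its jumps, `c` grows at least like a square root. -/
lemma sq_mul_le_of_jump (hG : G.IsDistanceRegularWith b c) {t : ℕ} (ht : 1 ≤ t) (hct : 2 ≤ c t)
    (x : ℕ) (hx : x ≤ G.diam) (hjump : c (x - 1) < c x) (hcx : c t ≤ c x) :
    c t ^ 2 * x ≤ 2 * t * c x ^ 2 := by
  induction x using Nat.strong_induction_on with
  | _ x ih =>
    rcases le_or_gt x (2 * t) with hx2 | hx2
    · calc c t ^ 2 * x ≤ c x ^ 2 * (2 * t) := by gcongr
        _ = 2 * t * c x ^ 2 := by ring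
    have h1 := hG.c_mono (i := t) (j := x - t) (by omega) (by omega)
    -- Passing to the last jump `y` up to `x - t` keeps the value `c (x - t)` and makes the
    -- induction hypothesis available.
    obtain ⟨y, hy2, hyx, hyjump, hy, hxy⟩ := hG.exists_last_jump (i := x - t) (by omega) (by omega)
    have ihy := ih y (by omega) (by omega) hyjump (by omega)
    rcases le_or_gt x (y + 2 * t) with hxy2 | hxy2
    · have h2 := hG.c_add_c_le hx hjump (j := x - t) (l := t) (by omega) ht (by omega)
      rw [← hy] at h1 h2
      calc c t ^ 2 * x ≤ c t ^ 2 * (y + 2 * t) := by gcongr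
        _ = c t ^ 2 * y + 2 * t * c t ^ 2 := by ring
        _ ≤ 2 * t * c y ^ 2 + 2 * t * c t ^ 2 := by gcongr
        _ ≤ 2 * t * (c y + c t) ^ 2 := by
          rw [add_sq, ← mul_add]
          gcongr
          omega
        _ ≤ 2 * t * c x ^ 2 := by gcongr
    have h2 := hG.c_add_c_le hx hjump (j := y) (l := x - y) (by omega) (by omega) (by omega)
    rcases le_or_gt (2 * y) x with hxy3 | hxy3
    · have h3 := hG.c_mono (i := y) (j := x - y) (by omega) (by omega)
      calc c t ^ 2 * x ≤ 2 * t * (2 * c y) ^ 2 := by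
            rcases le_or_gt t y with hty | hty
            · calc c t ^ 2 * x ≤ c t ^ 2 * (4 * y) := by gcongr; omega
                _ = 4 * (c t ^ 2 * y) := by ring
                _ ≤ 4 * (2 * t * c y ^ 2) := by gcongr
                _ = 2 * t * (2 * c y) ^ 2 := by ring
            · calc c t ^ 2 * x ≤ c y ^ 2 * (8 * t) := by gcongr <;> omega
                _ = 2 * t * (2 * c y) ^ 2 := by ring
        _ ≤ 2 * t * c x ^ 2 := by gcongr; omega
    · have h3 := hG.c_mono (i := x - y) (j := y) (by omega) (by omega)
      have h4 := hG.c_mono (i := t) (j := x - y) (by omega) (by omega)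
      obtain ⟨z, hz2, hzx, hzjump, hz, hxz⟩ :=
        hG.exists_last_jump (i := x - y) (by omega) (by omega)
      have ihz := ih z (by omega) (by omega) hzjump (by omega)
      rw [hz] at ihz
      -- The factor 3 lost in passing from `x - y` to its last jump `z` is paid for by the cross
      -- term of `(c y + c (x - y)) ^ 2`, because `c (x - y) ≤ c y`.
      calc c t ^ 2 * x ≤ c t ^ 2 * (y + 3 * z) := by gcongr; omega
        _ = c t ^ 2 * y + 3 * (c t ^ 2 * z) := by ring
        _ ≤ 2 * t * c y ^ 2 + 3 * (2 * t * c (x - y) ^ 2) := by gcongr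
        _ = 2 * t * (c y ^ 2 + 2 * c (x - y) * c (x - y) + c (x - y) ^ 2) := by ring
        _ ≤ 2 * t * (c y ^ 2 + 2 * c y * c (x - y) + c (x - y) ^ 2) := by gcongr
        _ = 2 * t * (c y + c (x - y)) ^ 2 := by ring
        _ ≤ 2 * t * c x ^ 2 := by gcongr

lemma sq_mul_le (hG : G.IsDistanceRegularWith b c) {t i : ℕ} (ht : 1 ≤ t) (hct : 2 ≤ c t)
    (hti : t ≤ i) (hi : i ≤ G.diam) : c t ^ 2 * i ≤ 6 * t * c i ^ 2 := by
  have h1 := hG.c_mono hti hi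
  obtain ⟨j, hj2, hji, hjump, hj, hij⟩ := hG.exists_last_jump hi (by omega)
  have h2 := hG.sq_mul_le_of_jump ht hct j (by omega) hjump (by omega)
  rw [hj] at h2
  calc c t ^ 2 * i ≤ c t ^ 2 * (3 * j) := by gcongr
    _ = 3 * (c t ^ 2 * j) := by ring
    _ ≤ 3 * (2 * t * c i ^ 2) := by gcongr
    _ = 6 * t * c i ^ 2 := by ring

/-- Geodesics of length `i` with `c i = 1` are unique. -/
lemma eq_of_between (hG : G.IsDistanceRegularWith b c) {x w y y' : V} (h : c (G.dist x w) = 1)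
    (hy : G.dist x y + G.dist y w = G.dist x w) (hy' : G.dist x y' + G.dist y' w = G.dist x w)
    (hyy' : G.dist x y = G.dist x y') : y = y' := by
  obtain ⟨n, hn⟩ : ∃ n, G.dist y w = n := ⟨_, rfl⟩
  induction n generalizing w with
  | zero =>
    rw [hG.connected.dist_eq_zero_iff.1 hn,
      hG.connected.dist_eq_zero_iff.1 (show G.dist y' w = 0 by omega)]
  | succ n ih =>
    rcases Nat.eq_zero_or_pos (G.dist x y) with h0 | h0
    · rw [← hG.connected.dist_eq_zero_iff.1 h0,
        ← hG.connected.dist_eq_zero_iff.1 (show G.dist x y' = 0 by omega)]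
    obtain ⟨v, hv⟩ := hG.connected.closer_nonempty (x := y) (y := w) (by omega)
    obtain ⟨v', hv'⟩ := hG.connected.closer_nonempty (x := y') (y := w) (by omega)
    have hxv := hG.connected.closer_subset hy hv
    have hxv' := hG.connected.closer_subset hy' hv'
    obtain rfl : v = v' :=
      Finset.card_le_one.1 (by rw [hG.card_closer, h]) v hxv v' hxv'
    rw [mem_closer] at hv hv' hxv
    have hD := hG.dist_le_diam x w
    have h1 := hG.c_mono (i := G.dist x v) (j := G.dist x w) (by omega) hD
    have h2 := hG.c_pos (i := G.dist x v) (by omega) (by omega)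
    exact ih (w := v) (by omega) (by omega) (by omega) (by omega)

/-- The midpoint `y` of a geodesic of length `2 * t` has more than `2 * b t` neighbours, so one of
them is farther from neither end. It is a second midpoint, impossible if `c (2 * t) = 1`. -/
lemma two_le_c_two_mul (hG : G.IsDistanceRegularWith b c) {t : ℕ} (ht : 1 ≤ t)
    (hD : 2 * t ≤ G.diam) (hbt : 2 * b t < b 0) : 2 ≤ c (2 * t) := by
  classical
  by_contra! hlt
  have h1 := hG.c_pos (i := 2 * t) (by omega) hD
  obtain ⟨x, w, hxw⟩ := hG.exists_dist_eq hD
  obtain ⟨y, hxy, hyw⟩ := hG.connected.exists_between x w (i := t) (by omega)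
  have cwy := G.dist_comm (u := w) (v := y)
  obtain ⟨y', hy', hny'⟩ := Finset.exists_mem_notMem_of_card_lt_card
    (s := G.farther x y ∪ G.farther w y) (t := G.farther y y) (by
      refine (Finset.card_union_le _ _).trans_lt ?_
      rw [hG.card_farther, hG.card_farther, hG.card_farther, dist_self, hxy,
        show G.dist w y = t by omega]
      omega)
  rw [mem_farther] at hy'
  rw [Finset.mem_union, not_or, mem_farther, mem_farther] at hny'
  have h2 := hG.connected.dist_adj_bounds hy'.1 x
  have h3 := hG.connected.dist_adj_bounds hy'.1 w
  have h4 : G.dist x y' ≠ G.dist x y + 1 := fun h => hny'.1 ⟨hy'.1, h⟩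
  have h5 : G.dist w y' ≠ G.dist w y + 1 := fun h => hny'.2 ⟨hy'.1, h⟩
  have h6 := hG.connected.dist_triangle (u := x) (v := y') (w := w)
  have cwy' := G.dist_comm (u := w) (v := y')
  exact hy'.1.ne (hG.eq_of_between (x := x) (w := w) (by rw [hxw]; omega) hyw
    (by omega) (by omega))

end IsDistanceRegularWith

end SimpleGraph

/-! ### The diameter bound -/

theorem lemma10 {V : Type*} [Fintype V] (G : SimpleGraph V) (b c : ℕ → ℕ)
    (hG : G.IsDistanceRegularWith b c) (C : ℝ) (hC : 1 / 2 ≤ C) (t : ℕ) (ht : 1 ≤ t)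
    (hD : t + 1 ≤ G.diam) (hbc : (b t : ℝ) / (c t : ℝ) ≤ C) :
    (G.diam : ℝ) ≤ 8 * C ^ 2 * (t : ℝ) ∨ (b 0 : ℝ) ≤ 2 * C := by
  by_contra! hcon
  obtain ⟨hDC, hk⟩ := hcon
  have ht0 : (1 : ℝ) ≤ t := by exact_mod_cast ht
  have hct := hG.c_pos ht (by omega)
  have hct0 : (0 : ℝ) < c t := by exact_mod_cast hct
  rw [div_le_iff₀ hct0] at hbc
  have hD2 : 2 * t ≤ G.diam := by
    have h1 : (1 / 2 : ℝ) ^ 2 * t ≤ C ^ 2 * t := by gcongr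
    have : (2 * t : ℝ) ≤ G.diam := by linarith
    exact_mod_cast this
  -- Since `2 * t ≤ D`, also `c t ≤ b t ≤ C * c t`.
  have hC1 : 1 ≤ C := by
    have h1 : (c t : ℝ) ≤ b t := by exact_mod_cast hG.c_le_b (i := t) (j := t) (by omega)
    by_contra! h
    nlinarith
  have htC : (t : ℝ) ≤ C ^ 2 * t := le_mul_of_one_le_left (by positivity) (one_le_pow₀ hC1)
  have hD3 : 3 * t ≤ G.diam := by
    have : (3 * t : ℝ) ≤ G.diam := by linarith
    exact_mod_cast this
  have hcD : (c (G.diam - t) : ℝ) ≤ C * c t :=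
    le_trans (by exact_mod_cast hG.c_le_b (by omega)) hbc
  have hsub : ((G.diam - t : ℕ) : ℝ) = G.diam - t := Nat.cast_sub (by omega)
  rcases le_or_gt 2 (c t) with h2 | h2
  · have h3 : (c t : ℝ) ^ 2 * ((G.diam - t : ℕ) : ℝ) ≤ 6 * t * (c (G.diam - t) : ℝ) ^ 2 := by
      exact_mod_cast hG.sq_mul_le ht h2 (i := G.diam - t) (by omega) (by omega)
    rw [hsub] at h3
    have h4 : (c t : ℝ) ^ 2 * (G.diam - t) ≤ (c t : ℝ) ^ 2 * (6 * C ^ 2 * t) :=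
      calc _ ≤ _ := h3
        _ ≤ 6 * t * (C * c t) ^ 2 := by gcongr
        _ = _ := by ring
    have h5 := le_of_mul_le_mul_left h4 (by positivity)
    linarith
  · have h1 : c t = 1 := by omega
    rw [h1, Nat.cast_one, mul_one] at hbc hcD
    have hbk : 2 * b t < b 0 := by
      have : (2 * b t : ℝ) < b 0 := by linarith
      exact_mod_cast this
    have h2t := hG.two_le_c_two_mul ht hD2 hbk
    have h3 : (c (2 * t) : ℝ) ^ 2 * ((G.diam - t : ℕ) : ℝ) ≤
        6 * ((2 * t : ℕ) : ℝ) * (c (G.diam - t) : ℝ) ^ 2 := by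
      exact_mod_cast hG.sq_mul_le (t := 2 * t) (by omega) h2t (i := G.diam - t) (by omega)
        (by omega)
    have h4 : (2 : ℝ) ^ 2 * ((G.diam - t : ℕ) : ℝ) ≤
        (c (2 * t) : ℝ) ^ 2 * ((G.diam - t : ℕ) : ℝ) := by
      gcongr
      exact_mod_cast h2t
    rw [hsub] at h3 h4
    push_cast at h3
    have h5 : 6 * (2 * t : ℝ) * (c (G.diam - t) : ℝ) ^ 2 ≤ 6 * (2 * t : ℝ) * C ^ 2 := by
      gcongr
    linarith
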